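/- Let $\sigma\ge 0$ and let $(\alpha_j)_{j}$ be a finite or countably infinite family of nonzero real numbers with $\sum_j \alpha_j^{-2}<\infty$. Let $g$ be the entire function $$g(z)=e^{-\sigma^2 z}\prod_{j}\Bigl(1-\frac{z}{\alpha_j^2}\Bigr)=\sum_{k=0}^\infty \frac{\eta_k}{k!}z^k .$$ For every $d\ge 1$ let $n=n_d>-1$ be a real number (it may depend on $d$; in particular it may be fixed), let $$L_{d,g}(z)=\sum_{k=0}^d \eta_k\,(n+d)_k\binom{d}{k}z^{d-k},\qquad (x)_k=x(x-1)\cdots(x-k+1),$$ be the index $n$ Laguerre–Appell polynomial of $g$, and let $\tilde L_{d,g}$ be the polynomial obtained from $L_{d,g}$ by multiplying all its roots by $\frac{1}{d(n+d)}$, that is, $\tilde L_{d,g}(z)=a^{d}L_{d,g}(z/a)$ with $a=\frac1{d(n+d)}$. Then $\tilde L_{d,g}$ has degree $d$ and all its roots are real and non-negative. Moreover, if $\mu_{\tilde L_{d,g}}=\frac1d\sum_{x}\delta_x$ denotes its empirical root measure (the sum over the $d$ roots $x$ of $\tilde L_{d,g}$ with multiplicity), then, as $d\to\infty$, the finite measures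 $d\,t\,\mathrm{d}\mu_{\tilde L_{d,g}}(t)$ on $\mathbb R$ converge weakly to the finite measure $$G_g=\sigma^2\delta_0+\sum_{j}\frac{1}{\alpha_j^2}\,\delta_{1/\alpha_j^2},$$ that is, $\int \varphi(t)\,d\,t\,\mathrm{d}\mu_{\tilde L_{d,g}}(t)\to\int\varphi\,\mathrm{d}G_g$ for every bounded continuous $\varphi:\mathbb R\to\mathbb R$. -/

import Mathlib

open Polynomial MeasureTheory Filter Topology
open scoped ENNReal

noncomputable section

/-- The coefficient `η_k` in `g(z) = ∑ η_k z^k / k!`, i.e. the `k`-th derivative of `g` at `0`.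
It is only used for functions that are real on the real line, so that it is a real number. -/
def taylorCoeff (g : ℂ → ℂ) (k : ℕ) : ℝ := (iteratedDeriv k g 0).re

/-- The index `n` Laguerre--Appell polynomial
`L_{d,g}(z) = ∑_{k=0}^d η_k (n+d)_k (d choose k) z^(d-k)` of degree `d`, where
`(x)_k = x (x-1) ⋯ (x-k+1)` is the falling factorial. -/
def laguerreAppell (n : ℝ) (g : ℂ → ℂ) (d : ℕ) : ℝ[X] :=
  ∑ k ∈ Finset.range (d + 1),
    C (taylorCoeff g k * (descPochhammer ℝ k).eval (n + d) * (d.choose k : ℝ)) * X ^ (d - k)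

/-- The polynomial `L_{d,g}` with its roots multiplied by `1 / (d (n + d))`:
`scaleRoots p a` is `a ^ (deg p) * p (x / a)` for `a ≠ 0`. -/
def scaledLaguerreAppell (n : ℝ) (g : ℂ → ℂ) (d : ℕ) : ℝ[X] :=
  (laguerreAppell n g d).scaleRoots ((d * (n + d))⁻¹)

/-- The empirical root measure `(1 / deg p) ∑ δ_x`, the sum being over the real roots of `p`
with multiplicity. -/
def empiricalRootMeasure (p : ℝ[X]) : Measure ℝ :=
  (p.natDegree : ℝ≥0∞)⁻¹ • (p.roots.map fun x => Measure.dirac x).sum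

/-- The measure `d t dμ_p(t)`, where `μ_p` is the empirical root measure of `p`
(for polynomials all of whose roots are non-negative). -/
def weightedRootMeasure (d : ℕ) (p : ℝ[X]) : Measure ℝ :=
  (d : ℝ≥0∞) • (empiricalRootMeasure p).withDensity fun t => ENNReal.ofReal t

/-- The measure `G_g = σ² δ_0 + ∑_j α_j⁻² δ_{1 / α_j²}`. -/
def limitMeasure {ι : Type*} (σ : ℝ) (α : ι → ℝ) : Measure ℝ :=
  ENNReal.ofReal (σ ^ 2) • Measure.dirac 0 +
    Measure.sum fun j => ENNReal.ofReal (1 / α j ^ 2) • Measure.dirac (1 / α j ^ 2)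

end

/-!
The polynomial `laguerreAppell n g d` is `g(T) z^d` with `T = z D² + (n + 1) D`, and its zeros are
controlled in two stages. Call a monic real polynomial nonnegatively rooted if all its complex
roots lie in `[0, ∞)` (`NonnegRooted`). This class is preserved by

* `p ↦ p - c p'` for `c ≥ 0` and `p ↦ (z p' + s p) / (d + s)` for `s > 0`, because
  `p' / p = ∑ 1 / (z - x)` has the form `conj z * T - U` with `T, U ≥ 0`
  (`NonnegRooted.exists_aeval_derivative`);
* scaling of the roots by a positive factor;
* coefficientwise limits, because `|p(z)| ≥ δ ^ d` when `z` has distance at least `δ` from `[0, ∞)`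
  (`NonnegRooted.of_tendsto`).

The function `g` is the limit of the polynomials `∏ (1 - c z)` over finite multisets `approxZeros`
of nonnegative `c`: `N` copies of `σ² / N`, and finitely many `α_j⁻²`. Operators `1 - c D` applied to
`z^d` then give the Appell polynomial of `g`, and the remaining factor `(n + d)_k` is the limit of
rescaled products over `j = 1, …, N` of the multipliers `(d - k + n + j) / (d + n + j)` of `z^(d - k)`,
each of which is an operator of the second kind with `s = n + j` (`NonnegRooted.mul_descPochhammer`).

For the convergence, let `x` run through the roots of the rescaled polynomial of degree `d`. The
`k`-th coefficient of `∏ (1 - x z)` is `(η_k / k!) · (n + d)_k / (n + d)^k · (d)_k / d^k`, which tends to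
`η_k / k!`, the limit of the corresponding coefficient for `approxZeros`. By Newton's identities
the power sums are determined by these coefficients, so the power sums of the roots and those of
`approxZeros` have the same limits (`tendsto_sum_map_pow`); for the latter these are the moments of
the limit measure. All the measures live on one bounded interval, and the Weierstrass approximation
theorem turns convergence of moments into weak convergence (`tendsto_sum_mul_of_continuous`).
-/

noncomputable section

/-! ### Polynomials whose roots are all real and nonnegative -/

/-- `p` is monic of degree `d`, and all its complex roots are real and nonnegative. -/
def NonnegRooted (d : ℕ) (p : ℝ[X]) : Prop :=
  p.Monic ∧ p.natDegree = d ∧ p.Splits ∧ ∀ x ∈ p.roots, 0 ≤ x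

namespace NonnegRooted

variable {d : ℕ} {p : ℝ[X]}

theorem aeval_eq_prod (hp : NonnegRooted d p) (z : ℂ) :
    aeval z p = (p.roots.map fun x : ℝ => z - x).prod := by
  have h := hp.2.2.1.eq_prod_roots_of_monic hp.1
  conv_lhs => rw [h]
  rw [map_multiset_prod, Multiset.map_map]
  simp

/-- A polynomial with leading term `z^d` that does not vanish on `ℂ \ [0, ∞)` is nonnegatively
rooted; the condition on `z` says exactly that `z ∉ [0, ∞)`. -/
theorem of_aeval_ne_zero (hd : p.coeff d = 1) (hlt : ∀ m, d < m → p.coeff m = 0)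
    (h : ∀ z : ℂ, z.im ≠ 0 ∨ z.re < 0 → aeval z p ≠ 0) : NonnegRooted d p := by
  have hle : p.natDegree ≤ d := natDegree_le_iff_coeff_eq_zero.2 hlt
  have hm : p.Monic := monic_of_natDegree_le_of_coeff_eq_one d hle hd
  refine ⟨hm, natDegree_eq_of_le_of_coeff_ne_zero hle (by simp [hd]), ?_, ?_⟩
  · refine Splits.of_splits_map (algebraMap ℝ ℂ) (IsAlgClosed.splits _) ?_
    intro z hz
    have hz0 : aeval z p = 0 := by
      have := (mem_roots'.1 hz).2
      rwa [IsRoot, eval_map_algebraMap] at this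
    by_contra hne
    refine h z (Or.inl fun him => hne ⟨z.re, ?_⟩) hz0
    apply Complex.ext <;> simp [him]
  · intro x hx
    by_contra! hneg
    refine h (x : ℂ) (Or.inr (by simpa using hneg)) ?_
    have := (mem_roots'.1 hx).2
    rw [← Complex.coe_algebraMap, aeval_algebraMap_apply, coe_aeval_eq_eval, this.eq_zero, map_zero]

/-- The lower bound for `|p(z)|` depends on `p` only through `d`, so it survives limits. -/
theorem pow_le_norm_aeval (hp : NonnegRooted d p) {z : ℂ} {δ : ℝ} (hδ : 0 ≤ δ)
    (h : ∀ x : ℝ, 0 ≤ x → δ ≤ ‖z - x‖) : δ ^ d ≤ ‖aeval z p‖ := by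
  have key : ∀ S : Multiset ℝ, (∀ x ∈ S, 0 ≤ x) →
      δ ^ S.card ≤ ‖(S.map fun x : ℝ => z - x).prod‖ := by
    intro S
    induction S using Multiset.induction with
    | empty => simp
    | cons a S ih =>
      intro hS
      rw [Multiset.card_cons, pow_succ', Multiset.map_cons, Multiset.prod_cons, norm_mul]
      exact mul_le_mul (h a (hS a (by simp))) (ih fun x hx => hS x (by simp [hx]))
        (by positivity) (norm_nonneg _)
  rw [hp.aeval_eq_prod, ← hp.2.1, hp.2.2.1.natDegree_eq_card_roots]
  exact key _ hp.2.2.2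

theorem exists_dist_pos {z : ℂ} (hz : z.im ≠ 0 ∨ z.re < 0) :
    ∃ δ : ℝ, 0 < δ ∧ ∀ x : ℝ, 0 ≤ x → δ ≤ ‖z - x‖ := by
  rcases hz with hz | hz
  · refine ⟨|z.im|, abs_pos.2 hz, fun x _ => ?_⟩
    simpa using Complex.abs_im_le_norm (z - x)
  · refine ⟨-z.re, by linarith, fun x hx => ?_⟩
    have := (abs_le.1 (Complex.abs_re_le_norm (z - x))).1
    simp only [Complex.sub_re, Complex.ofReal_re] at this
    linarith

theorem aeval_ne_zero (hp : NonnegRooted d p) {z : ℂ} (hz : z.im ≠ 0 ∨ z.re < 0) :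
    aeval z p ≠ 0 := by
  obtain ⟨δ, hδ, h⟩ := exists_dist_pos hz
  exact norm_pos_iff.1 ((pow_pos hδ d).trans_le (hp.pow_le_norm_aeval hδ.le h))

/-- Coefficientwise limits of nonnegatively rooted polynomials of fixed degree are nonnegatively
rooted: the bound `pow_le_norm_aeval` keeps the limit from vanishing off `[0, ∞)`. -/
theorem of_tendsto {I : Type*} {l : Filter I} [l.NeBot] {P : I → ℝ[X]}
    (hP : ∀ᶠ i in l, NonnegRooted d (P i))
    (h : ∀ m, Tendsto (fun i => (P i).coeff m) l (𝓝 (p.coeff m))) : NonnegRooted d p := by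
  have hlt : ∀ m, d < m → p.coeff m = 0 := by
    intro m hm
    refine tendsto_nhds_unique (h m) (tendsto_const_nhds.congr' ?_)
    filter_upwards [hP] with i hi
    exact (coeff_eq_zero_of_natDegree_lt (by rw [hi.2.1]; exact hm)).symm
  refine of_aeval_ne_zero ?_ hlt ?_
  · refine tendsto_nhds_unique (h d) (tendsto_const_nhds.congr' ?_)
    filter_upwards [hP] with i hi
    rw [← hi.2.1, coeff_natDegree, hi.1.leadingCoeff]
  · intro z hz
    obtain ⟨δ, hδ, hδz⟩ := exists_dist_pos hz
    have haeval : ∀ q : ℝ[X], q.natDegree ≤ d →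
        aeval z q = ∑ k ∈ Finset.range (d + 1), (q.coeff k : ℂ) * z ^ k := by
      intro q hq
      rw [aeval_eq_sum_range' (Nat.lt_succ_of_le hq)]
      simp [Algebra.smul_def]
    have hlim : Tendsto (fun i => aeval z (P i)) l (𝓝 (aeval z p)) := by
      rw [haeval p (natDegree_le_iff_coeff_eq_zero.2 hlt)]
      have : Tendsto (fun i => ∑ k ∈ Finset.range (d + 1), ((P i).coeff k : ℂ) * z ^ k) l
          (𝓝 (∑ k ∈ Finset.range (d + 1), (p.coeff k : ℂ) * z ^ k)) :=
        tendsto_finsetSum _ fun k _ =>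
          ((Complex.continuous_ofReal.tendsto _).comp (h k)).mul_const _
      refine this.congr' ?_
      filter_upwards [hP] with i hi
      rw [haeval _ hi.2.1.le]
    have : δ ^ d ≤ ‖aeval z p‖ := by
      refine ge_of_tendsto hlim.norm ?_
      filter_upwards [hP] with i hi
      exact hi.pow_le_norm_aeval hδ.le hδz
    exact norm_pos_iff.1 ((pow_pos hδ d).trans_le this)

/-- The shape of `p' / p = ∑ 1 / (z - x)` off `[0, ∞)`: multiplying numerator and denominator by
`conj z - x` gives `conj z * T - U` with `T = ∑ |z - x|⁻²` and `U = ∑ x |z - x|⁻²`. -/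
theorem exists_aeval_derivative (hp : NonnegRooted d p) {z : ℂ} (hz : z.im ≠ 0 ∨ z.re < 0) :
    ∃ T U : ℝ, 0 ≤ T ∧ 0 ≤ U ∧
      aeval z (derivative p) = aeval z p * ((starRingEnd ℂ) z * T - U) := by
  have hne : ∀ x : ℝ, 0 ≤ x → z - x ≠ 0 := by
    intro x hx h0
    obtain ⟨δ, hδ, h⟩ := exists_dist_pos hz
    have := h x hx
    rw [h0, norm_zero] at this
    linarith
  have key : ∀ S : Multiset ℝ, (∀ x ∈ S, 0 ≤ x) → ∃ T U : ℝ, 0 ≤ T ∧ 0 ≤ U ∧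
      aeval z (derivative (S.map fun x => X - C x).prod) =
        aeval z (S.map fun x => X - C x).prod * ((starRingEnd ℂ) z * T - U) := by
    intro S
    induction S using Multiset.induction with
    | empty => exact fun _ => ⟨0, 0, le_rfl, le_rfl, by simp⟩
    | cons a S ih =>
      intro hS
      obtain ⟨T, U, hT, hU, h⟩ := ih fun x hx => hS x (by simp [hx])
      have ha : 0 ≤ a := hS a (by simp)
      have hN : 0 < Complex.normSq (z - a) := Complex.normSq_pos.2 (hne a ha)
      refine ⟨T + (Complex.normSq (z - a))⁻¹, U + a * (Complex.normSq (z - a))⁻¹,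
        by positivity, by positivity, ?_⟩
      have hinv : (z - a) * (((starRingEnd ℂ) z - a) * (Complex.normSq (z - a) : ℂ)⁻¹) = 1 := by
        have h1 : (starRingEnd ℂ) z - a = (starRingEnd ℂ) (z - a) := by simp
        rw [h1, ← mul_assoc, Complex.mul_conj, mul_inv_cancel₀]
        exact_mod_cast hN.ne'
      rw [Multiset.map_cons, Multiset.prod_cons, derivative_mul]
      simp only [derivative_X, derivative_C, sub_zero, one_mul, map_add, map_mul,
        map_sub, aeval_X, aeval_C, h, Complex.coe_algebraMap]
      push_cast
      linear_combination -(aeval z (S.map fun x => X - C x).prod) * hinv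
  have := key p.roots hp.2.2.2
  rwa [← hp.2.2.1.eq_prod_roots_of_monic hp.1] at this

theorem coeff_self (hp : NonnegRooted d p) : p.coeff d = 1 := by
  rw [← hp.2.1, coeff_natDegree, hp.1.leadingCoeff]

theorem coeff_of_lt (hp : NonnegRooted d p) {m : ℕ} (hm : d < m) : p.coeff m = 0 :=
  coeff_eq_zero_of_natDegree_lt (by rwa [hp.2.1])

theorem sub_C_mul_derivative (hp : NonnegRooted d p) {c : ℝ} (hc : 0 ≤ c) :
    NonnegRooted d (p - C c * derivative p) := by
  refine of_aeval_ne_zero ?_ ?_ ?_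
  · simp [coeff_derivative, hp.coeff_self, hp.coeff_of_lt]
  · intro m hm
    simp [coeff_derivative, hp.coeff_of_lt hm, hp.coeff_of_lt (hm.trans (Nat.lt_succ_self m))]
  · intro z hz h0
    obtain ⟨T, U, hT, hU, h⟩ := hp.exists_aeval_derivative hz
    have h1 : (c : ℂ) * ((starRingEnd ℂ) z * T - U) = 1 := by
      apply mul_left_cancel₀ (hp.aeval_ne_zero hz)
      simp only [map_sub, map_mul, aeval_C, Complex.coe_algebraMap, h] at h0
      linear_combination -h0
    have hre := congrArg Complex.re h1
    have him := congrArg Complex.im h1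
    simp at hre him
    have hcT := mul_nonneg hc hT
    have hcU := mul_nonneg hc hU
    -- The imaginary part of `c (conj z * T - U) = 1` forces `c T = 0`, or else `re z < 0`; in both
    -- cases the real part of the left-hand side is at most `-c U ≤ 0`.
    rcases hz with hz | hz
    · rcases him with rfl | him | rfl
      · simp at hre
      · exact hz him
      · simp at hre; linarith
    · nlinarith

theorem coeff_X_mul_derivative (p : ℝ[X]) (m : ℕ) :
    (X * derivative p).coeff m = m * p.coeff m := by
  cases m with
  | zero => simp
  | succ m => rw [coeff_X_mul, coeff_derivative]; push_cast; ring

theorem X_mul_derivative_add (hp : NonnegRooted d p) {s : ℝ} (hs : 0 < s) :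
    NonnegRooted d (C (s + d)⁻¹ * (X * derivative p + C s * p)) := by
  have hsd : 0 < s + d := by positivity
  refine of_aeval_ne_zero ?_ ?_ ?_
  · rw [coeff_C_mul, coeff_add, coeff_C_mul, coeff_X_mul_derivative, hp.coeff_self]
    field_simp
    ring
  · intro m hm
    rw [coeff_C_mul, coeff_add, coeff_C_mul, coeff_X_mul_derivative, hp.coeff_of_lt hm]
    simp
  · intro z hz h0
    obtain ⟨T, U, hT, hU, h⟩ := hp.exists_aeval_derivative hz
    have h1 : z * ((starRingEnd ℂ) z * T - U) + s = 0 := by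
      apply mul_left_cancel₀ (hp.aeval_ne_zero hz)
      have h2 : ((s + d : ℝ) : ℂ)⁻¹ ≠ 0 := inv_ne_zero (by exact_mod_cast hsd.ne')
      simp only [map_add, map_mul, aeval_C, aeval_X, Complex.coe_algebraMap, h, map_inv₀] at h0
      have h3 := (mul_eq_zero.1 h0).resolve_left (by simpa using h2)
      linear_combination h3
    have hre := congrArg Complex.re h1
    have him := congrArg Complex.im h1
    simp at hre him
    have hzT : 0 ≤ (z.re * z.re + z.im * z.im) * T :=
      mul_nonneg (add_nonneg (mul_self_nonneg _) (mul_self_nonneg _)) hT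
    -- The equation reads `|z|² T + s = z U`, so its right-hand side is real and positive. If
    -- `im z ≠ 0` then `U = 0`; if `re z < 0` the right-hand side has nonpositive real part.
    rcases hz with hz | hz
    · have hU0 : U = 0 := by
        have : z.im * U = 0 := by linarith
        exact (mul_eq_zero.1 this).resolve_left hz
      rw [hU0] at hre
      nlinarith
    · nlinarith [mul_nonneg (neg_nonneg.2 hz.le) hU]

theorem scaleRoots (hp : NonnegRooted d p) {a : ℝ} (ha : 0 < a) :
    NonnegRooted d (p.scaleRoots a) := by
  refine of_aeval_ne_zero ?_ ?_ ?_
  · rw [coeff_scaleRoots, hp.coeff_self, hp.2.1]; simp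
  · intro m hm
    rw [coeff_scaleRoots, hp.coeff_of_lt hm, zero_mul]
  · intro z hz h0
    have hz' : (z / a).im ≠ 0 ∨ (z / a).re < 0 := by
      rcases hz with hz | hz
      · left; rw [Complex.div_ofReal_im]; exact div_ne_zero hz ha.ne'
      · right; rw [Complex.div_ofReal_re]; exact div_neg_of_neg_of_pos hz ha
    have ha' : (a : ℂ) ≠ 0 := by exact_mod_cast ha.ne'
    have h1 := scaleRoots_eval₂_mul (p := p) (f := algebraMap ℝ ℂ) (z / a) a
    rw [Complex.coe_algebraMap, mul_div_cancel₀ _ ha'] at h1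
    rw [aeval_def, h1] at h0
    exact hp.aeval_ne_zero hz' ((mul_eq_zero.1 h0).resolve_left (pow_ne_zero _ ha'))

theorem X_pow (d : ℕ) : NonnegRooted d (X ^ d) :=
  ⟨monic_X_pow d, natDegree_X_pow d, Splits.X_pow d, fun x hx => by
    rw [roots_X_pow] at hx
    exact (Multiset.mem_singleton.1 (Multiset.mem_of_mem_nsmul hx)).ge⟩

end NonnegRooted

/-! ### Appell polynomials and falling factorial multipliers -/

/-- The polynomial `∑_{k ≤ d} u_k z^(d - k)`, written by descending powers. -/
def revPoly (d : ℕ) (u : ℕ → ℝ) : ℝ[X] :=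
  ∑ k ∈ Finset.range (d + 1), C (u k) * X ^ (d - k)

theorem coeff_revPoly (d : ℕ) (u : ℕ → ℝ) {k m : ℕ} (h : m + k = d) :
    (revPoly d u).coeff m = u k := by
  rw [revPoly, finsetSum_coeff, Finset.sum_eq_single k]
  · rw [coeff_C_mul, coeff_X_pow, if_pos (by omega), mul_one]
  · intro j hj hjk
    rw [Finset.mem_range] at hj
    rw [coeff_C_mul, coeff_X_pow, if_neg (by omega), mul_zero]
  · intro hk
    exact absurd (Finset.mem_range.2 (by omega)) hk

theorem coeff_revPoly_of_lt (d : ℕ) (u : ℕ → ℝ) {m : ℕ} (h : d < m) :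
    (revPoly d u).coeff m = 0 := by
  rw [revPoly, finsetSum_coeff]
  refine Finset.sum_eq_zero fun k _ => ?_
  rw [coeff_C_mul, coeff_X_pow, if_neg (by omega), mul_zero]

theorem ext_revPoly {d : ℕ} {u : ℕ → ℝ} {p : ℝ[X]} (hlt : ∀ m, d < m → p.coeff m = 0)
    (h : ∀ k m, m + k = d → p.coeff m = u k) : p = revPoly d u := by
  ext m
  rcases lt_or_ge d m with hm | hm
  · rw [hlt m hm, coeff_revPoly_of_lt d u hm]
  · have : m + (d - m) = d := by omega
    rw [h _ m this, coeff_revPoly d u this]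

/-- The polynomial `∏ (1 - c z)`, the product being over the multiset `S` of all `c`. Its
roots are the inverses of the nonzero elements of `S`. -/
def revProd (S : Multiset ℝ) : ℝ[X] := (S.map fun c => 1 - C c * X).prod

theorem revProd_zero : revProd 0 = 1 := by simp [revProd]

theorem revProd_cons (c : ℝ) (S : Multiset ℝ) :
    revProd (c ::ₘ S) = (1 - C c * X) * revProd S := by simp [revProd]

theorem revProd_add (S T : Multiset ℝ) : revProd (S + T) = revProd S * revProd T := by
  simp [revProd]

theorem coeff_zero_revProd (S : Multiset ℝ) : (revProd S).coeff 0 = 1 := by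
  induction S using Multiset.induction with
  | empty => simp [revProd_zero]
  | cons c S ih => simp [revProd_cons, mul_coeff_zero, ih]

theorem coeff_succ_revProd_cons (c : ℝ) (S : Multiset ℝ) (k : ℕ) :
    (revProd (c ::ₘ S)).coeff (k + 1) = (revProd S).coeff (k + 1) - c * (revProd S).coeff k := by
  rw [revProd_cons, sub_mul, one_mul, coeff_sub, mul_assoc, coeff_C_mul, coeff_X_mul]

theorem coeff_revProd (S : Multiset ℝ) (k : ℕ) :
    (revProd S).coeff k = (-1) ^ k * S.esymm k := by
  induction S using Multiset.induction generalizing k with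
  | empty =>
    cases k with
    | zero => simp [revProd_zero, Multiset.esymm]
    | succ k =>
      rw [revProd_zero, Multiset.esymm, Multiset.powersetCard_zero_right]
      simp [coeff_one]
  | cons c S ih =>
    cases k with
    | zero => simp [coeff_zero_revProd, Multiset.esymm]
    | succ k =>
      rw [coeff_succ_revProd_cons, ih, ih]
      simp only [Multiset.esymm, Multiset.powersetCard_cons, Multiset.map_add, Multiset.map_map,
        Multiset.sum_add, Function.comp_def, Multiset.prod_cons, Multiset.sum_map_mul_left]
      ring

/-- The Appell polynomial of `h = ∏ (1 - c z)` is `h(D) z^d = ∏ (1 - c D) z^d`. -/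
theorem nonnegRooted_appell {S : Multiset ℝ} (hS : ∀ c ∈ S, 0 ≤ c) (d : ℕ) :
    NonnegRooted d (revPoly d fun k => (revProd S).coeff k * d.descFactorial k) := by
  induction S using Multiset.induction with
  | empty =>
    convert NonnegRooted.X_pow d
    refine (ext_revPoly (fun m hm => ?_) fun k m hk => ?_).symm
    · rw [coeff_X_pow, if_neg hm.ne']
    · rw [coeff_X_pow, revProd_zero, coeff_one]
      rcases Nat.eq_zero_or_pos k with rfl | hpos
      · simp at hk; simp [hk]
      · rw [if_neg (by omega), if_neg (by omega), zero_mul]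
  | cons c S ih =>
    have h := (ih fun x hx => hS x (by simp [hx])).sub_C_mul_derivative (hS c (by simp))
    convert h using 1
    refine (ext_revPoly (fun m hm => h.coeff_of_lt hm) fun k m hk => ?_).symm
    rw [coeff_sub, coeff_C_mul, coeff_derivative, coeff_revPoly _ _ hk]
    cases k with
    | zero => rw [coeff_revPoly_of_lt _ _ (by omega)]; simp [coeff_zero_revProd]
    | succ k =>
      rw [coeff_revPoly d _ (show m + 1 + k = d by omega), coeff_succ_revProd_cons,
        Nat.descFactorial_succ, show d - k = m + 1 by omega]
      push_cast
      ring

/-- By telescoping, the multiplier `∏_{i < k} (n + d - i) / (n + d - i + N)` of `z^(d - k)` equals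
`∏_{j = 1}^N (d - k + n + j) / (d + n + j)`, and the `j`-th factor is the multiplier of the operator
`p ↦ (z p' + (n + j) p) / (d + n + j)`. -/
theorem NonnegRooted.mul_prod_div {d : ℕ} {u : ℕ → ℝ} (hu : NonnegRooted d (revPoly d u)) {n : ℝ}
    (hn : -1 < n) (N : ℕ) : NonnegRooted d (revPoly d fun k =>
      u k * ∏ i ∈ Finset.range k, ((n + d - i) / (n + d - i + N))) := by
  have hpos : ∀ {i k m : ℕ}, m + k = d → i < k → (0 : ℝ) < n + d - i := by
    intro i k m hk hi
    have h1 : (i : ℝ) + 1 ≤ k := by exact_mod_cast hi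
    have h2 : (m : ℝ) + k = d := by exact_mod_cast hk
    have h3 : (0 : ℝ) ≤ m := Nat.cast_nonneg m
    linarith
  induction N with
  | zero =>
    convert hu using 1
    refine (ext_revPoly (fun m hm => hu.coeff_of_lt hm) fun k m hk => ?_).symm
    rw [coeff_revPoly _ _ hk, Finset.prod_eq_one, mul_one]
    intro i hi
    rw [Nat.cast_zero, add_zero]
    exact div_self (hpos hk (Finset.mem_range.1 hi)).ne'
  | succ N ih =>
    have hs : 0 < n + N + 1 := by have : (0 : ℝ) ≤ N := Nat.cast_nonneg N; linarith
    have h := ih.X_mul_derivative_add hs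
    convert h using 1
    refine (ext_revPoly (fun m hm => h.coeff_of_lt hm) fun k m hk => ?_).symm
    rw [coeff_C_mul, coeff_add, coeff_C_mul, NonnegRooted.coeff_X_mul_derivative,
      coeff_revPoly _ _ hk]
    have hd : 0 < n + N + 1 + d := by positivity
    -- The ratio of the multipliers for `N + 1` and for `N`.
    have tele : ∀ k m : ℕ, m + k = d →
        (∏ i ∈ Finset.range k, ((n + d - i) / (n + d - i + N))) * (n + d - k + N + 1) =
        (n + N + 1 + d) * ∏ i ∈ Finset.range k, ((n + d - i) / (n + d - i + (N + 1 : ℕ))) := by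
      intro k
      induction k with
      | zero => intro m _; simp; ring
      | succ k ihk =>
        intro m hm
        have ih' := ihk (m + 1) (by omega)
        have h1 := hpos hm (Nat.lt_succ_self k)
        have h2 : 0 < n + d - k + N := by positivity
        have h3 : 0 < n + d - k + ((N + 1 : ℕ) : ℝ) := by positivity
        rw [Finset.prod_range_succ, Finset.prod_range_succ, ← mul_assoc, ← ih']
        push_cast at h3 ⊢
        have h4 : n + d - k + N + 1 ≠ 0 := by rw [← add_assoc] at h3; exact h3.ne'
        rw [← add_assoc]
        field_simp
        ring
    have hm : (m : ℝ) = d - k := by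
      rw [eq_sub_iff_add_eq]; exact_mod_cast hk
    have := tele k m hk
    rw [hm, inv_mul_eq_div, eq_comm, eq_div_iff hd.ne']
    linear_combination (-(u k)) * this

/-- The multipliers of `mul_prod_div`, multiplied by `N^k`, tend to the falling factorial
`(n + d)_k` as `N → ∞`; the factor `N^k` is a scaling of the roots. -/
theorem NonnegRooted.mul_descPochhammer {d : ℕ} {u : ℕ → ℝ} (hu : NonnegRooted d (revPoly d u))
    {n : ℝ} (hn : -1 < n) :
    NonnegRooted d (revPoly d fun k => u k * (descPochhammer ℝ k).eval (n + d)) := by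
  refine NonnegRooted.of_tendsto (l := atTop) (P := fun N : ℕ => (revPoly d fun k =>
    u k * ∏ i ∈ Finset.range k, ((n + d - i) / (n + d - i + N))).scaleRoots (N : ℝ)) ?_ ?_
  · filter_upwards [eventually_ge_atTop 1] with N hN
    exact (hu.mul_prod_div hn N).scaleRoots (by exact_mod_cast hN)
  · intro m
    rcases lt_or_ge d m with hm | hm
    · simp [coeff_scaleRoots, coeff_revPoly_of_lt _ _ hm]
    · have hk : m + (d - m) = d := by omega
      set k := d - m with hkdef
      simp only [coeff_scaleRoots, coeff_revPoly _ _ hk, (hu.mul_prod_div hn _).2.1, ← hkdef,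
        mul_assoc]
      refine Tendsto.const_mul _ ?_
      rw [descPochhammer_eval_eq_prod_range]
      have : Tendsto (fun N : ℕ => ∏ i ∈ Finset.range k,
          ((n + d - i) * ((N : ℝ) / (N + (n + d - i))))) atTop
          (𝓝 (∏ i ∈ Finset.range k, ((n + d - i) * 1))) :=
        tendsto_finsetProd _ fun i _ =>
          (tendsto_natCast_div_add_atTop (n + d - i : ℝ)).const_mul _
      simp only [mul_one] at this
      refine this.congr fun N => ?_
      rw [← Finset.card_range k, ← Finset.prod_const, Finset.card_range, ← Finset.prod_mul_distrib]
      refine Finset.prod_congr rfl fun i _ => ?_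
      rw [add_comm (N : ℝ)]
      ring

/-! ### Taylor coefficients of a canonical product -/

theorem tendsto_descPochhammer_div_pow {I : Type*} {l : Filter I} {x : I → ℝ}
    (hx : Tendsto x l atTop) (k : ℕ) :
    Tendsto (fun i => (descPochhammer ℝ k).eval (x i) / x i ^ k) l (𝓝 1) := by
  have : Tendsto (fun i => ∏ j ∈ Finset.range k, (1 - j / x i)) l
      (𝓝 (∏ j ∈ Finset.range k, (1 - 0))) :=
    tendsto_finsetProd _ fun j _ => tendsto_const_nhds.sub (hx.const_div_atTop (j : ℝ))
  simp only [sub_zero, Finset.prod_const_one] at this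
  refine this.congr' ?_
  filter_upwards [hx.eventually_gt_atTop 0] with i hi
  rw [descPochhammer_eval_eq_prod_range]
  nth_rewrite 3 [← Finset.card_range k]
  rw [← Finset.prod_const, ← Finset.prod_div_distrib]
  refine Finset.prod_congr rfl fun j _ => ?_
  field_simp

theorem tendsto_choose_div_pow (k : ℕ) :
    Tendsto (fun N : ℕ => (N.choose k : ℝ) / N ^ k) atTop (𝓝 (1 / (k.factorial : ℝ))) := by
  have := (tendsto_descPochhammer_div_pow (tendsto_natCast_atTop_atTop (R := ℝ)) k).div_const
    (k.factorial : ℝ)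
  refine this.congr fun N => ?_
  have hk : (k.factorial : ℝ) ≠ 0 := by exact_mod_cast k.factorial_ne_zero
  rw [descPochhammer_eval_eq_descFactorial, Nat.descFactorial_eq_factorial_mul_choose]
  push_cast
  field_simp

theorem coeff_revProd_replicate (N : ℕ) (c : ℝ) (k : ℕ) :
    (revProd (Multiset.replicate N c)).coeff k = N.choose k * (-c) ^ k := by
  induction N generalizing k with
  | zero => cases k <;> simp [revProd_zero, coeff_one]
  | succ N ih =>
    cases k with
    | zero => simp [coeff_zero_revProd]
    | succ k =>
      rw [Multiset.replicate_succ, coeff_succ_revProd_cons, ih, ih, Nat.choose_succ_succ]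
      push_cast
      ring

theorem tendsto_coeff_revProd_replicate (c : ℝ) (k : ℕ) :
    Tendsto (fun N : ℕ => (revProd (Multiset.replicate N (c / N))).coeff k) atTop
      (𝓝 ((-c) ^ k / k.factorial)) := by
  have := (tendsto_choose_div_pow k).mul_const ((-c) ^ k)
  rw [one_div_mul_eq_div] at this
  refine this.congr fun N => ?_
  rw [coeff_revProd_replicate, ← neg_div, div_pow]
  ring

theorem iteratedDeriv_aeval_zero (p : ℝ[X]) (k : ℕ) :
    iteratedDeriv k (fun z : ℂ => aeval z p) 0 = (k.factorial * p.coeff k : ℝ) := by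
  have h : ∀ k, iteratedDeriv k (fun z : ℂ => aeval z p) =
      fun z => aeval z (derivative^[k] p) := by
    intro k
    induction k with
    | zero => simp
    | succ k ih =>
      rw [iteratedDeriv_succ, ih, Function.iterate_succ_apply']
      funext z
      exact (Polynomial.hasDerivAt_aeval _ z).deriv
  rw [h]
  simp only [← coeff_zero_eq_aeval_zero', coeff_iterate_derivative, zero_add,
    Nat.descFactorial_self, nsmul_eq_mul, Complex.coe_algebraMap]

theorem tendsto_iteratedDeriv {I : Type*} {l : Filter I} [l.NeBot] {F : I → ℂ → ℂ} {f : ℂ → ℂ}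
    (hF : ∀ i, Differentiable ℂ (F i)) (h : TendstoLocallyUniformlyOn F f l Set.univ) (k : ℕ)
    (z : ℂ) : Tendsto (fun i => iteratedDeriv k (F i) z) l (𝓝 (iteratedDeriv k f z)) := by
  induction k generalizing F f with
  | zero => simpa using h.tendsto_at (Set.mem_univ z)
  | succ k ih =>
    simp only [iteratedDeriv_succ']
    exact ih (fun i => (hF i).deriv)
      (h.deriv (Eventually.of_forall fun i => (hF i).differentiableOn) isOpen_univ)

theorem aeval_revProd (S : Multiset ℝ) (z : ℂ) :
    aeval z (revProd S) = (S.map fun c : ℝ => 1 - c * z).prod := by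
  rw [revProd, map_multiset_prod, Multiset.map_map]
  simp

section product

variable {ι : Type*} {c : ι → ℝ}

theorem tendstoLocallyUniformlyOn_prod (hc : ∀ j, 0 ≤ c j) (hsum : Summable c) :
    TendstoLocallyUniformlyOn (fun (s : Finset ι) (z : ℂ) => aeval z (revProd (s.val.map c)))
      (fun z => ∏' j, (1 - (c j : ℂ) * z)) atTop Set.univ := by
  have h : HasProdLocallyUniformlyOn (fun j (z : ℂ) => 1 + -((c j : ℂ) * z))
      (fun z => ∏' j, (1 + -((c j : ℂ) * z))) Set.univ := by
    refine hasProdLocallyUniformlyOn_of_forall_compact isOpen_univ fun K _ hK => ?_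
    obtain ⟨R, hR⟩ := hK.isBounded.exists_norm_le
    refine Summable.hasProdUniformlyOn_one_add hK (hsum.mul_right R)
      (Eventually.of_forall fun j z hz => ?_) fun j => by fun_prop
    rw [norm_neg, norm_mul, Complex.norm_real, Real.norm_of_nonneg (hc j)]
    exact mul_le_mul_of_nonneg_left (hR z hz) (hc j)
  simp only [← sub_eq_add_neg] at h
  refine (hasProdLocallyUniformlyOn_iff_tendstoLocallyUniformlyOn.1 h).congr fun s z _ => ?_
  rw [aeval_revProd, Multiset.map_map]
  rfl

theorem tendsto_coeff_revProd_finset (hc : ∀ j, 0 ≤ c j) (hsum : Summable c) (k : ℕ) :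
    Tendsto (fun s : Finset ι => (((revProd (s.val.map c)).coeff k : ℝ) : ℂ)) atTop
      (𝓝 (iteratedDeriv k (fun z : ℂ => ∏' j, (1 - (c j : ℂ) * z)) 0 / k.factorial)) := by
  have h := (tendsto_iteratedDeriv (fun s => Polynomial.differentiable_aeval _)
    (tendstoLocallyUniformlyOn_prod hc hsum) k 0).div_const (k.factorial : ℂ)
  refine h.congr fun s => ?_
  have hk : (k.factorial : ℂ) ≠ 0 := by exact_mod_cast k.factorial_ne_zero
  rw [iteratedDeriv_aeval_zero]
  push_cast
  field_simp

/-- The numbers `c` in the factors `1 - c z` of a polynomial approximating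
`exp (-τ z) * ∏' (1 - c_j z)`: the pair `(N, s)` stands for `(1 - τ z / N)^N * ∏_{j ∈ s} (1 - c_j z)`. -/
def approxZeros (τ : ℝ) (c : ι → ℝ) (i : ℕ × Finset ι) : Multiset ℝ :=
  Multiset.replicate i.1 (τ / i.1) + i.2.val.map c

theorem approxZeros_nonneg {τ : ℝ} (hτ : 0 ≤ τ) (hc : ∀ j, 0 ≤ c j) (i : ℕ × Finset ι) :
    ∀ x ∈ approxZeros τ c i, 0 ≤ x := by
  intro x hx
  rcases Multiset.mem_add.1 hx with h | h
  · rw [Multiset.eq_of_mem_replicate h]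
    positivity
  · obtain ⟨j, _, rfl⟩ := Multiset.mem_map.1 h
    exact hc j

theorem tendsto_coeff_revProd_approxZeros (τ : ℝ) (hc : ∀ j, 0 ≤ c j) (hsum : Summable c)
    {g : ℂ → ℂ} (hg : ∀ z, g z = Complex.exp (-τ * z) * ∏' j, (1 - (c j : ℂ) * z)) (k : ℕ) :
    Tendsto (fun i => (revProd (approxZeros τ c i)).coeff k) atTop
      (𝓝 (taylorCoeff g k / k.factorial)) := by
  set H : ℂ → ℂ := fun z => ∏' j, (1 - (c j : ℂ) * z) with hH
  have hHd : Differentiable ℂ H := by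
    rw [← differentiableOn_univ]
    exact (tendstoLocallyUniformlyOn_prod hc hsum).differentiableOn
      (Eventually.of_forall fun s => (Polynomial.differentiable_aeval _).differentiableOn)
      isOpen_univ
  -- Leibniz rule, so that the two factors of `g` can be approximated separately.
  have hgk : iteratedDeriv k g 0 / k.factorial = ∑ x ∈ Finset.HasAntidiagonal.antidiagonal k,
      (((-τ) ^ x.1 / x.1.factorial : ℝ) : ℂ) * (iteratedDeriv x.2 H 0 / x.2.factorial) := by
    have hg' : g = (fun z => Complex.exp (-τ * z)) * H := funext hg
    rw [hg', iteratedDeriv_mul (by fun_prop) (hHd.contDiff.contDiffAt),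
      Finset.Nat.sum_antidiagonal_eq_sum_range_succ_mk, Finset.sum_div]
    refine Finset.sum_congr rfl fun i hi => ?_
    have hik : i ≤ k := Nat.lt_succ_iff.1 (Finset.mem_range.1 hi)
    have h1 := congrFun (iteratedDeriv_cexp_const_mul i (-(τ : ℂ))) 0
    simp only [mul_zero, Complex.exp_zero, mul_one] at h1
    rw [h1, Nat.cast_choose ℂ hik]
    have hf : ∀ m : ℕ, (m.factorial : ℂ) ≠ 0 := fun m => by exact_mod_cast m.factorial_ne_zero
    have := hf k
    have := hf i
    have := hf (k - i)
    push_cast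
    field_simp
  have hlim : Tendsto (fun i => (((revProd (approxZeros τ c i)).coeff k : ℝ) : ℂ)) atTop
      (𝓝 (iteratedDeriv k g 0 / k.factorial)) := by
    rw [hgk]
    simp only [approxZeros, revProd_add, coeff_mul]
    push_cast
    refine tendsto_finsetSum _ fun x _ => Tendsto.mul ?_ ?_
    · rw [← prod_atTop_atTop_eq]
      have := (tendsto_coeff_revProd_replicate τ x.1).comp
        (tendsto_fst (f := (atTop : Filter ℕ)) (g := (atTop : Filter (Finset ι))))
      have := (Complex.continuous_ofReal.tendsto _).comp this
      push_cast at this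
      exact this
    · rw [← prod_atTop_atTop_eq]
      exact (tendsto_coeff_revProd_finset hc hsum x.2).comp tendsto_snd
  have := (Complex.continuous_re.tendsto _).comp hlim
  simp only [Function.comp_def, Complex.ofReal_re, Complex.div_natCast_re] at this
  exact this

end product

/-! ### Power sums and Weierstrass approximation -/

/-- Newton's identity, in terms of the coefficients of `∏ (1 - x z)`. -/
theorem sum_map_pow_eq (S : Multiset ℝ) {k : ℕ} (hk : 0 < k) :
    (S.map fun x => x ^ k).sum = -(k * (revProd S).coeff k) -
      ∑ a ∈ Finset.HasAntidiagonal.antidiagonal k with a.1 ∈ Set.Ioo 0 k,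
        (revProd S).coeff a.1 * (S.map fun x => x ^ a.2).sum := by
  classical
  have h := congrArg (MvPolynomial.aeval fun x : S.ToType => (x : ℝ))
    (MvPolynomial.psum_eq_mul_esymm_sub_sum S.ToType ℝ k hk)
  have hp : ∀ m, MvPolynomial.aeval (fun x : S.ToType => (x : ℝ)) (MvPolynomial.psum S.ToType ℝ m) =
      (S.map fun x => x ^ m).sum := by
    intro m
    rw [MvPolynomial.psum, map_sum]
    simp only [map_pow, MvPolynomial.aeval_X]
    conv_rhs => rw [← Multiset.map_univ_coe S, Multiset.map_map]
    rfl
  have he : ∀ m, MvPolynomial.aeval (fun x : S.ToType => (x : ℝ))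
      (MvPolynomial.esymm S.ToType ℝ m) = S.esymm m := by
    intro m
    rw [MvPolynomial.aeval_esymm_eq_multiset_esymm, Multiset.map_univ_coe]
  simp only [map_sub, map_mul, map_pow, map_neg, map_one, map_natCast, map_sum, hp, he] at h
  rw [h]
  simp only [coeff_revProd]
  ring

/-- If the coefficients of `∏ (1 - x z)` over two families of multisets have the same limits, then so
do the power sums. This needs only that the power sums of one family converge, since by Newton's
identities each power sum is a polynomial in the coefficients. -/
theorem tendsto_sum_map_pow {I J : Type*} {l : Filter I} {l' : Filter J} [l'.NeBot]
    {S : I → Multiset ℝ} {T : J → Multiset ℝ} {w P : ℕ → ℝ}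
    (hS : ∀ k, Tendsto (fun i => (revProd (S i)).coeff k) l (𝓝 (w k)))
    (hT : ∀ k, Tendsto (fun i => (revProd (T i)).coeff k) l' (𝓝 (w k)))
    (hP : ∀ k, 0 < k → Tendsto (fun i => ((T i).map fun x => x ^ k).sum) l' (𝓝 (P k)))
    {k : ℕ} (hk : 0 < k) :
    Tendsto (fun i => ((S i).map fun x => x ^ k).sum) l (𝓝 (P k)) := by
  induction k using Nat.strong_induction_on with
  | _ k ih =>
    have hmem : ∀ a ∈ (Finset.HasAntidiagonal.antidiagonal k).filter fun a => a.1 ∈ Set.Ioo 0 k,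
        0 < a.2 ∧ a.2 < k := by
      intro a ha
      rw [Finset.mem_filter, Finset.HasAntidiagonal.mem_antidiagonal, Set.mem_Ioo] at ha
      omega
    have h1 := ((hT k).const_mul (k : ℝ)).neg.sub (tendsto_finsetSum _ fun a ha =>
      (hT a.1).mul (hP a.2 (hmem a ha).1))
    have h2 := ((hS k).const_mul (k : ℝ)).neg.sub (tendsto_finsetSum _ fun a ha =>
      (hS a.1).mul (ih a.2 (hmem a ha).2 (hmem a ha).1))
    simp only [← sum_map_pow_eq _ hk] at h1 h2
    rwa [tendsto_nhds_unique (hP k hk) h1]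

section

variable {ι : Type*} {c : ι → ℝ}

theorem summable_pow_succ (hc : ∀ j, 0 ≤ c j) (hsum : Summable c) (m : ℕ) :
    Summable fun j => c j ^ (m + 1) := by
  refine Summable.of_nonneg_of_le (fun j => pow_nonneg (hc j) _) (fun j => ?_)
    (hsum.mul_left ((∑' j, c j) ^ m))
  rw [pow_succ]
  exact mul_le_mul_of_nonneg_right (pow_le_pow_left₀ (hc j)
    (hsum.le_tsum j fun i _ => hc i) m) (hc j)

theorem tendsto_sum_map_pow_approxZeros (τ : ℝ) (hc : ∀ j, 0 ≤ c j) (hsum : Summable c) (m : ℕ) :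
    Tendsto (fun i => ((approxZeros τ c i).map fun x => x ^ (m + 1)).sum) atTop
      (𝓝 (τ * 0 ^ m + ∑' j, c j ^ (m + 1))) := by
  simp only [approxZeros, Multiset.map_add, Multiset.sum_add, Multiset.map_replicate,
    Multiset.sum_replicate, Multiset.map_map]
  rw [← prod_atTop_atTop_eq]
  refine Tendsto.add (Tendsto.comp (g := fun N : ℕ => N • (τ / N) ^ (m + 1)) (y := atTop) ?_
    tendsto_fst) ((summable_pow_succ hc hsum m).hasSum.comp tendsto_snd)
  have : Tendsto (fun N : ℕ => τ * (τ / N) ^ m) atTop (𝓝 (τ * 0 ^ m)) :=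
    ((tendsto_const_div_atTop_nhds_zero_nat τ).pow m).const_mul τ
  refine this.congr' ?_
  filter_upwards [eventually_gt_atTop 0] with N hN
  have : (N : ℝ) ≠ 0 := by exact_mod_cast hN.ne'
  rw [nsmul_eq_mul, pow_succ']
  field_simp

/-- Convergence of the power sums, extended linearly to integrals of polynomials against
`∑ x δ_x`. -/
theorem tendsto_sum_mul_eval {I : Type*} {l : Filter I} {S : I → Multiset ℝ} {τ : ℝ}
    (hc : ∀ j, 0 ≤ c j) (hsum : Summable c)
    (hS : ∀ m, Tendsto (fun i => ((S i).map fun x => x ^ (m + 1)).sum) l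
      (𝓝 (τ * 0 ^ m + ∑' j, c j ^ (m + 1)))) (q : ℝ[X]) :
    (Summable fun j => c j * q.eval (c j)) ∧
    Tendsto (fun i => ((S i).map fun x => x * q.eval x).sum) l
      (𝓝 (τ * q.eval 0 + ∑' j, c j * q.eval (c j))) := by
  induction q using Polynomial.induction_on' with
  | add p q hp hq =>
    simp only [eval_add, mul_add, Multiset.sum_map_add]
    refine ⟨hp.1.add hq.1, ?_⟩
    rw [hp.1.tsum_add hq.1]
    convert hp.2.add hq.2 using 2
    ring
  | monomial m a =>
    have h : ∀ x : ℝ, x * (a * x ^ m) = a * x ^ (m + 1) := fun x => by ring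
    simp only [eval_monomial, h, Multiset.sum_map_mul_left, tsum_mul_left]
    refine ⟨(summable_pow_succ hc hsum m).mul_left a, ?_⟩
    convert (hS m).const_mul a using 2
    ring

theorem abs_sum_map_mul_le {S : Multiset ℝ} {f : ℝ → ℝ} {ε : ℝ} (hS : ∀ x ∈ S, 0 ≤ x)
    (hf : ∀ x ∈ S, |f x| ≤ ε) : |(S.map fun x => x * f x).sum| ≤ ε * S.sum := by
  induction S using Multiset.induction with
  | empty => simp
  | cons a S ih =>
    simp only [Multiset.map_cons, Multiset.sum_cons, mul_add]
    have ha := hS a (by simp)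
    refine (abs_add_le _ _).trans (add_le_add ?_
      (ih (fun x hx => hS x (by simp [hx])) fun x hx => hf x (by simp [hx])))
    rw [abs_mul, abs_of_nonneg ha, mul_comm]
    exact mul_le_mul_of_nonneg_right (hf a (by simp)) ha

/-- Convergence of the moments of `∑ x δ_x` implies convergence of its integrals against
continuous functions. The first power sum bounds both the total mass and the support. -/
theorem tendsto_sum_mul_of_continuous {I : Type*} {l : Filter I} {S : I → Multiset ℝ} {τ : ℝ}
    (hτ : 0 ≤ τ) (hc : ∀ j, 0 ≤ c j) (hsum : Summable c) (hS0 : ∀ i, ∀ x ∈ S i, 0 ≤ x)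
    (hS : ∀ m, Tendsto (fun i => ((S i).map fun x => x ^ (m + 1)).sum) l
      (𝓝 (τ * 0 ^ m + ∑' j, c j ^ (m + 1)))) {f : ℝ → ℝ} (hf : Continuous f)
    (hfsum : Summable fun j => c j * f (c j)) :
    Tendsto (fun i => ((S i).map fun x => x * f x).sum) l
      (𝓝 (τ * f 0 + ∑' j, c j * f (c j))) := by
  -- Eventually all the measures are supported in `[0, M]` and have total mass at most `M`. The
  -- summand `1` leaves room for sums that are close to their limit `τ + ∑ c_j`.
  set M := τ + ∑' j, c j + 1 with hM
  have htsum : 0 ≤ ∑' j, c j := tsum_nonneg hc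
  have hMpos : 0 < M := by positivity
  have hSM : ∀ᶠ i in l, (S i).sum < M := by
    have := hS 0
    simp only [zero_add, pow_one, pow_zero, mul_one, Multiset.map_id'] at this
    exact this.eventually_lt_const (by linarith)
  have hcM : ∀ j, c j ∈ Set.Icc 0 M := fun j =>
    ⟨hc j, by have := hsum.le_tsum j fun i _ => hc i; linarith⟩
  rw [Metric.tendsto_nhds]
  intro ε hε
  set δ := ε / (4 * M) with hδ
  have hδpos : 0 < δ := by positivity
  obtain ⟨q, hq⟩ := exists_polynomial_near_of_continuousOn 0 M f hf.continuousOn δ hδpos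
  obtain ⟨hqsum, hqlim⟩ := tendsto_sum_mul_eval hc hsum hS q
  filter_upwards [hSM, Metric.tendsto_nhds.1 hqlim (ε / 2) (by positivity)] with i hi hqi
  have h1 : |((S i).map fun x => x * q.eval x).sum - ((S i).map fun x => x * f x).sum| ≤
      δ * (S i).sum := by
    rw [← Multiset.sum_map_sub]
    simp only [← mul_sub]
    refine abs_sum_map_mul_le (f := fun x => q.eval x - f x) (hS0 i) fun x hx => (hq x ?_).le
    exact ⟨hS0 i x hx, (Multiset.single_le_sum (hS0 i) x hx).trans hi.le⟩
  have h2 : |(τ * q.eval 0 + ∑' j, c j * q.eval (c j)) - (τ * f 0 + ∑' j, c j * f (c j))| ≤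
      δ * (τ + ∑' j, c j) := by
    have e : (τ * q.eval 0 + ∑' j, c j * q.eval (c j)) - (τ * f 0 + ∑' j, c j * f (c j)) =
        τ * (q.eval 0 - f 0) + ∑' j, c j * (q.eval (c j) - f (c j)) := by
      simp only [mul_sub]
      rw [hqsum.tsum_sub hfsum]
      ring
    rw [e, mul_add]
    refine (abs_add_le _ _).trans (add_le_add ?_ ?_)
    · rw [abs_mul, abs_of_nonneg hτ, mul_comm]
      exact mul_le_mul_of_nonneg_right (hq 0 ⟨le_rfl, hMpos.le⟩).le hτ
    · rw [← tsum_mul_left, ← Real.norm_eq_abs]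
      refine tsum_of_norm_bounded (hsum.mul_left δ).hasSum fun j => ?_
      rw [Real.norm_eq_abs, abs_mul, abs_of_nonneg (hc j), mul_comm]
      exact mul_le_mul_of_nonneg_right (hq _ (hcM j)).le (hc j)
  have hδM : δ * M = ε / 4 := by rw [hδ]; field_simp
  have h3 : δ * (S i).sum < ε / 4 := by rw [← hδM]; exact mul_lt_mul_of_pos_left hi hδpos
  have h4 : δ * (τ + ∑' j, c j) < ε / 4 := by
    rw [← hδM]; exact mul_lt_mul_of_pos_left (by linarith) hδpos
  rw [Real.dist_eq] at hqi ⊢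
  rw [abs_le] at h1 h2
  rw [abs_lt] at hqi ⊢
  constructor <;> linarith

end

/-! ### Root measures -/

theorem withDensity_dirac (a : ℝ) (f : ℝ → ℝ≥0∞) :
    (Measure.dirac a).withDensity f = f a • Measure.dirac a := by
  classical
  ext s hs
  rw [withDensity_apply _ hs, setLIntegral_dirac]
  by_cases ha : a ∈ s <;> simp [ha, hs]

/-- The normalisations `d` and `1 / d` cancel. For `d = 0` there are no roots, and both sides
vanish. -/
theorem weightedRootMeasure_eq {d : ℕ} {p : ℝ[X]} (hp : p.natDegree = d) :
    weightedRootMeasure d p = (p.roots.map fun x => ENNReal.ofReal x • Measure.dirac x).sum := by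
  have key : ∀ S : Multiset ℝ,
      (S.map fun x => Measure.dirac x).sum.withDensity (fun t => ENNReal.ofReal t) =
        (S.map fun x => ENNReal.ofReal x • Measure.dirac x).sum := by
    intro S
    induction S using Multiset.induction with
    | empty => simp
    | cons a S ih =>
      rw [Multiset.map_cons, Multiset.sum_cons, withDensity_add_measure, ih, Multiset.map_cons,
        Multiset.sum_cons, withDensity_dirac]
  rw [weightedRootMeasure, empiricalRootMeasure, withDensity_smul_measure, key, hp, smul_smul]
  rcases Nat.eq_zero_or_pos d with rfl | hd
  -- Here `(natDegree)⁻¹ = ∞`, which multiplies the zero measure.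
  · have : p.roots = 0 := by
      rw [eq_C_of_natDegree_eq_zero hp, roots_C]
    simp [this]
  · rw [ENNReal.mul_inv_cancel (by exact_mod_cast hd.ne') (ENNReal.natCast_ne_top d), one_smul]

theorem isFiniteMeasure_sum_dirac (S : Multiset ℝ) :
    IsFiniteMeasure (S.map fun x => ENNReal.ofReal x • Measure.dirac x).sum := by
  induction S using Multiset.induction with
  | empty => rw [Multiset.map_zero, Multiset.sum_zero]; infer_instance
  | cons a S ih =>
    rw [Multiset.map_cons, Multiset.sum_cons]
    have : IsFiniteMeasure (ENNReal.ofReal a • Measure.dirac a) :=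
      Measure.smul_finite _ ENNReal.ofReal_ne_top
    infer_instance

theorem integral_sum_dirac_multiset {S : Multiset ℝ} (hS : ∀ x ∈ S, 0 ≤ x) (f : ℝ → ℝ) :
    Integrable f (S.map fun x => ENNReal.ofReal x • Measure.dirac x).sum ∧
    ∫ t, f t ∂(S.map fun x => ENNReal.ofReal x • Measure.dirac x).sum =
      (S.map fun x => x * f x).sum := by
  induction S using Multiset.induction with
  | empty => simp
  | cons a S ih =>
    obtain ⟨h1, h2⟩ := ih fun x hx => hS x (by simp [hx])
    have ha : Integrable f (ENNReal.ofReal a • Measure.dirac a) :=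
      (integrable_dirac (by simp)).smul_measure ENNReal.ofReal_ne_top
    simp only [Multiset.map_cons, Multiset.sum_cons]
    refine ⟨ha.add_measure h1, ?_⟩
    rw [integral_add_measure ha h1, h2, integral_smul_measure, integral_dirac,
      ENNReal.toReal_ofReal (hS a (by simp)), smul_eq_mul]

section

variable {ι : Type*} {σ : ℝ} {α : ι → ℝ}

theorem isFiniteMeasure_limitMeasure (hsum : Summable fun j => 1 / α j ^ 2) :
    IsFiniteMeasure (limitMeasure σ α) := by
  have h1 : IsFiniteMeasure (ENNReal.ofReal (σ ^ 2) • Measure.dirac (0 : ℝ)) :=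
    Measure.smul_finite _ ENNReal.ofReal_ne_top
  have h2 : IsFiniteMeasure
      (Measure.sum fun j => ENNReal.ofReal (1 / α j ^ 2) • Measure.dirac (1 / α j ^ 2)) := by
    refine ⟨?_⟩
    rw [Measure.sum_apply _ MeasurableSet.univ]
    simpa using hsum.tsum_ofReal_lt_top
  rw [limitMeasure]
  infer_instance

theorem summable_mul_of_bounded (hsum : Summable fun j => 1 / α j ^ 2)
    (f : BoundedContinuousFunction ℝ ℝ) : Summable fun j => 1 / α j ^ 2 * f (1 / α j ^ 2) := by
  refine Summable.of_norm_bounded (hsum.mul_right ‖f‖) fun j => ?_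
  rw [norm_mul, Real.norm_of_nonneg (by positivity : 0 ≤ 1 / α j ^ 2)]
  exact mul_le_mul_of_nonneg_left (f.norm_coe_le_norm _) (by positivity)

theorem integral_limitMeasure [Countable ι] (hsum : Summable fun j => 1 / α j ^ 2)
    (f : BoundedContinuousFunction ℝ ℝ) :
    ∫ t, f t ∂(limitMeasure σ α) = σ ^ 2 * f 0 + ∑' j, 1 / α j ^ 2 * f (1 / α j ^ 2) := by
  have hfin := isFiniteMeasure_limitMeasure (σ := σ) hsum
  have hint : Integrable f (limitMeasure σ α) := f.integrable _
  rw [limitMeasure] at hint ⊢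
  rw [integral_add_measure hint.left_of_add_measure hint.right_of_add_measure,
    integral_smul_measure, integral_dirac, ENNReal.toReal_ofReal (sq_nonneg σ), smul_eq_mul,
    integral_sum_dirac fun j => ENNReal.ofReal_ne_top]
  congr 1
  refine tsum_congr fun j => ?_
  rw [ENNReal.toReal_ofReal (by positivity), smul_eq_mul]

end

/-! ### Roots of the Laguerre--Appell polynomials -/

section

variable {ι : Type*} {τ : ℝ} {c : ι → ℝ} {g : ℂ → ℂ}

theorem neBot_atTop_nat_prod_finset (ι : Type*) : (atTop : Filter (ℕ × Finset ι)).NeBot := by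
  classical
  rw [← prod_atTop_atTop_eq]
  infer_instance

/-- For each `approxZeros`, the Laguerre--Appell polynomial arises from an Appell polynomial by the
multiplier `(n + d)_k`; the case of `g` is a coefficientwise limit. -/
theorem nonnegRooted_laguerreAppell (hτ : 0 ≤ τ) (hc : ∀ j, 0 ≤ c j) (hsum : Summable c)
    (hg : ∀ z, g z = Complex.exp (-τ * z) * ∏' j, (1 - (c j : ℂ) * z)) {n : ℝ} (hn : -1 < n)
    (d : ℕ) : NonnegRooted d (laguerreAppell n g d) := by
  have h := fun i => (nonnegRooted_appell (approxZeros_nonneg hτ hc i) d).mul_descPochhammer hn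
  have := neBot_atTop_nat_prod_finset ι
  refine NonnegRooted.of_tendsto (l := atTop) (Eventually.of_forall h) fun m => ?_
  change Tendsto _ _ (𝓝 ((revPoly d fun k => taylorCoeff g k * (descPochhammer ℝ k).eval (n + d) *
    (d.choose k : ℝ)).coeff m))
  rcases lt_or_ge d m with hm | hm
  · simp only [coeff_revPoly_of_lt _ _ hm]
    exact tendsto_const_nhds
  · have hk : m + (d - m) = d := by omega
    simp only [coeff_revPoly _ _ hk]
    have := ((tendsto_coeff_revProd_approxZeros τ hc hsum hg (d - m)).mul_const
      (d.descFactorial (d - m) : ℝ)).mul_const ((descPochhammer ℝ (d - m)).eval (n + d))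
    convert this using 2
    have hf : ((d - m).factorial : ℝ) ≠ 0 := by exact_mod_cast (d - m).factorial_ne_zero
    rw [Nat.descFactorial_eq_factorial_mul_choose]
    push_cast
    field_simp

theorem scale_pos {n : ℝ} (hn : -1 < n) {d : ℕ} (hd : 1 ≤ d) : 0 < (d * (n + d) : ℝ)⁻¹ := by
  have : (1 : ℝ) ≤ d := by exact_mod_cast hd
  exact inv_pos.2 (mul_pos (by linarith) (by linarith))

/-- Vieta's formula: `∏ (1 - x z)` is the reversed polynomial of `p`. -/
theorem coeff_revProd_roots {d : ℕ} {p : ℝ[X]} (hp : NonnegRooted d p) {k : ℕ} (hk : k ≤ d) :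
    (revProd p.roots).coeff k = p.coeff (d - k) := by
  rw [coeff_revProd, coeff_eq_esymm_roots_of_splits hp.2.2.1 (by rw [hp.2.1]; omega), hp.2.1,
    hp.1.leadingCoeff, one_mul, show d - (d - k) = k by omega]

/-- The `k`-th coefficient is `η_k (n + d)_k (d choose k) / (d (n + d))^k`, and `n + d → ∞`
because `n > -1`. -/
theorem tendsto_coeff_revProd_roots (hτ : 0 ≤ τ) (hc : ∀ j, 0 ≤ c j) (hsum : Summable c)
    (hg : ∀ z, g z = Complex.exp (-τ * z) * ∏' j, (1 - (c j : ℂ) * z)) {n : ℕ → ℝ}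
    (hn : ∀ d, -1 < n d) (k : ℕ) :
    Tendsto (fun d => (revProd (scaledLaguerreAppell (n d) g d).roots).coeff k) atTop
      (𝓝 (taylorCoeff g k / k.factorial)) := by
  have hx : Tendsto (fun d : ℕ => n d + d) atTop atTop :=
    tendsto_atTop_add_left_of_le _ (-1) (fun d => (hn d).le) tendsto_natCast_atTop_atTop
  have h := ((tendsto_descPochhammer_div_pow hx k).const_mul (taylorCoeff g k)).mul
    (tendsto_choose_div_pow k)
  rw [mul_one, mul_one_div] at h
  refine h.congr' ?_
  filter_upwards [eventually_ge_atTop (k + 1)] with d hd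
  have hL := nonnegRooted_laguerreAppell hτ hc hsum hg (hn d) d
  have hS := hL.scaleRoots (scale_pos (hn d) (show 1 ≤ d by omega))
  rw [scaledLaguerreAppell, coeff_revProd_roots hS (by omega), coeff_scaleRoots, hL.2.1,
    show d - (d - k) = k by omega]
  have : (laguerreAppell (n d) g d).coeff (d - k) =
      taylorCoeff g k * (descPochhammer ℝ k).eval (n d + d) * (d.choose k : ℝ) :=
    coeff_revPoly d _ (show d - k + k = d by omega)
  rw [this, inv_pow, mul_pow, mul_inv]
  ring

end

end

theorem theorem2p11 {ι : Type*} [Countable ι] (σ : ℝ) (hσ : 0 ≤ σ)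
    (α : ι → ℝ) (hα : ∀ j, α j ≠ 0) (hsum : Summable fun j => 1 / α j ^ 2)
    (g : ℂ → ℂ)
    (hg : ∀ z : ℂ, g z = Complex.exp (-(σ : ℂ) ^ 2 * z) * ∏' j, (1 - z / (α j : ℂ) ^ 2))
    (n : ℕ → ℝ) (hn : ∀ d, -1 < n d) :
    (∀ d : ℕ, 1 ≤ d →
      (scaledLaguerreAppell (n d) g d).natDegree = d ∧
      (scaledLaguerreAppell (n d) g d).Splits ∧
      ∀ x ∈ (scaledLaguerreAppell (n d) g d).roots, 0 ≤ x) ∧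
    ∃ (hρ : ∀ d : ℕ, IsFiniteMeasure (weightedRootMeasure d (scaledLaguerreAppell (n d) g d)))
      (hG : IsFiniteMeasure (limitMeasure σ α)),
      Tendsto (β := FiniteMeasure ℝ)
        (fun d => ⟨weightedRootMeasure d (scaledLaguerreAppell (n d) g d), hρ d⟩)
        atTop (𝓝 ⟨limitMeasure σ α, hG⟩) := by
  have hc : ∀ j, 0 ≤ 1 / α j ^ 2 := fun j => by positivity
  have hg' : ∀ z, g z = Complex.exp (-(σ ^ 2 : ℝ) * z) *
      ∏' j, (1 - ((1 / α j ^ 2 : ℝ) : ℂ) * z) := by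
    intro z
    rw [hg]
    push_cast
    simp only [one_div_mul_eq_div]
  have hL := fun d => nonnegRooted_laguerreAppell (sq_nonneg σ) hc hsum hg' (hn d) d
  have hS : ∀ d, 1 ≤ d → NonnegRooted d (scaledLaguerreAppell (n d) g d) := fun d hd =>
    (hL d).scaleRoots (scale_pos (hn d) hd)
  have hdeg : ∀ d, (scaledLaguerreAppell (n d) g d).natDegree = d := fun d => by
    rw [scaledLaguerreAppell, natDegree_scaleRoots, (hL d).2.1]
  have hroots : ∀ d, ∀ x ∈ (scaledLaguerreAppell (n d) g d).roots, 0 ≤ x := by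
    intro d
    rcases Nat.eq_zero_or_pos d with hd | hd
    · rw [eq_C_of_natDegree_eq_zero ((hdeg d).trans hd), roots_C]
      simp
    · exact (hS d hd).2.2.2
  have hfin := isFiniteMeasure_limitMeasure (σ := σ) hsum
  have hρ : ∀ d : ℕ,
      IsFiniteMeasure (weightedRootMeasure d (scaledLaguerreAppell (n d) g d)) := by
    intro d
    rw [weightedRootMeasure_eq (hdeg d)]
    exact isFiniteMeasure_sum_dirac _
  refine ⟨fun d hd => ⟨(hS d hd).2.1, (hS d hd).2.2⟩, hρ, hfin, ?_⟩
  refine FiniteMeasure.tendsto_iff_forall_integral_tendsto.2 fun f => ?_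
  change Tendsto (fun d => ∫ t, f t ∂(weightedRootMeasure d (scaledLaguerreAppell (n d) g d)))
    atTop (𝓝 (∫ t, f t ∂(limitMeasure σ α)))
  rw [integral_limitMeasure hsum]
  have := neBot_atTop_nat_prod_finset ι
  have hmom := fun m => tendsto_sum_map_pow
    (P := fun k => σ ^ 2 * 0 ^ (k - 1) + ∑' j, (1 / α j ^ 2) ^ k)
    (tendsto_coeff_revProd_roots (sq_nonneg σ) hc hsum hg' hn)
    (tendsto_coeff_revProd_approxZeros (σ ^ 2) hc hsum hg')
    (fun k hk => by
      obtain ⟨m, rfl⟩ : ∃ m, k = m + 1 := ⟨k - 1, by omega⟩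
      exact tendsto_sum_map_pow_approxZeros (σ ^ 2) hc hsum m) (Nat.succ_pos m)
  refine (tendsto_sum_mul_of_continuous (sq_nonneg σ) hc hsum hroots hmom f.continuous
    (summable_mul_of_bounded hsum f)).congr fun d => ?_
  rw [weightedRootMeasure_eq (hdeg d), (integral_sum_dirac_multiset (hroots d) f).2]
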